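/- **Theorem 4.5.** Let $(L,g_L)$ be a Riemannian manifold and $(K,\varphi,g_K)$ a Kähler manifold (finite-dimensional, smooth, without boundary; $\varphi$ is the complex structure, so $\varphi^2=-1$, $g_K(\varphi\cdot,\varphi\cdot)=g_K$, $\nabla^K\varphi=0$). Let $G:L\to K$ be a conformal pointwise-slant Riemannian map (CPSRM) with dilation $\lambda$ and slant function $\Theta$. That is: $G$ is smooth; $\lambda:L\to(0,\infty)$ is smooth and $g_K(G_*X,G_*Y)=\lambda^2g_L(X,Y)$ for $X,Y\in(\ker G_*)^\perp$; and $\Theta$ is a smooth real function on $L$ such that at every $p\in L$ the angle between $\varphi v$ and the subspace $(\mathrm{range}\,G_*)_p\subset T_{G(p)}K$ equals $\Theta(p)$ for every nonzero $v\in(\mathrm{range}\,G_*)_p$. Assume that $\Theta$ vanishes nowhere. *Notation.* For $w\in T_{G(p)}K$ let $w^{\mathrm{range}}$, $w^\perp$ be its components in $(\mathrm{range}\,G_*)_p$ and $(\mathrm{range}\,G_*)_p^\perp$. For $v\in\mathrm{range}\,G_*$ write $\varphi v=\rho v+\varpi v$ and for $P\in(\mathrm{range}\,G_*)^\perp$ write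 $\varphi P=\mathcal DP+\mathcal EP$, the first summand lying in $\mathrm{range}\,G_*$ and the second in $(\mathrm{range}\,G_*)^\perp$. Let $\nabla^L,\nabla^K$ be the Levi-Civita connections, $\nabla^G$ the pullback of $\nabla^K$ to vector fields along $G$, and $(\nabla G_*)(X,Y)=\nabla^G_XG_*Y-G_*(\nabla^L_XY)$ the second fundamental form of $G$. For a section $V$ of $(\mathrm{range}\,G_*)^\perp$ put $S_VG_*X=-(\nabla^G_XV)^{\mathrm{range}}$ and $\nabla^{G\perp}_XV=(\nabla^G_XV)^\perp$. Let ${}^*G_*$ be the adjoint of $G_*$ with respect to $g_L$ and $\lambda^{-2}g_K$, i.e. $g_L({}^*G_*w,X)=\lambda^{-2}g_K(w,G_*X)$; thus ${}^*G_*G_*Y=Y$ for horizontal $Y$. The trace of an expression in a horizontal vector field is $\sum_i(\text{expression at }e_i)$ for a smooth local orthonormal frame $(e_i)$ of $(\ker G_*)^\perp$; for the conditions below it is enough that near each point the sum vanishes at that point for one such frame. Then $G$ is harmonic, that is, $G$ is smooth and $\operatorname{trace}\nabla G_*=0$ on $L$, provided that (i) $\operatorname{trace}\big\{S_{\varpi\rho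 G_*(\cdot)}G_*(\cdot)+S_{\mathcal E\varpi G_*(\cdot)}G_*(\cdot)-G_*\big(\nabla^L_{(\cdot)}{}^*G_*(\mathcal D\varpi G_*(\cdot))\big)-(\nabla G_*)\big(\cdot,{}^*G_*(\mathcal D\varpi G_*(\cdot))\big)^{\mathrm{range}}-\sin2\Theta\,(\cdot)(\Theta)\,G_*(\cdot)-\sin^2\Theta\,G_*(\nabla^L_{(\cdot)}(\cdot))\big\}=0,$ (ii) $\operatorname{trace}\big\{\nabla^{G\perp}_{(\cdot)}\varpi\rho G_*(\cdot)+(\nabla G_*)\big(\cdot,{}^*G_*(\mathcal D\varpi G_*(\cdot))\big)^{\perp}+\nabla^{G\perp}_{(\cdot)}\mathcal E\varpi G_*(\cdot)\big\}=0,$ (iii) the fibers of $G$ are minimal: near each point there is a smooth local orthonormal frame $(w_j)$ of $\ker G_*$ for which the $(\ker G_*)^\perp$-component of $\sum_j\nabla^L_{w_j}w_j$ vanishes at that point (the value does not depend on the frame). -/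

import Mathlib

open Bundle
open scoped Manifold ContDiff Topology

namespace SlantRiemannianMap

noncomputable section

section Basics

variable {E : Type*} [NormedAddCommGroup E] [NormedSpace ℝ E]
  {M : Type*} [TopologicalSpace M] [ChartedSpace E M]

instance instFiniteDimensionalTangentSpace [FiniteDimensional ℝ E] (x : M) :
    FiniteDimensional ℝ (TangentSpace 𝓘(ℝ, E) x) :=
  inferInstanceAs (FiniteDimensional ℝ E)

/-- The derivative at `p`, in the direction `u`, of a function with values in a fixed vector
space. -/
def dirDeriv {W : Type*} [NormedAddCommGroup W] [NormedSpace ℝ W] (h : M → W) (p : M)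
    (u : TangentSpace 𝓘(ℝ, E) p) : W :=
  mfderiv 𝓘(ℝ, E) 𝓘(ℝ, W) h p u

variable [IsManifold 𝓘(ℝ, E) ∞ M]

/-- The local vector field with constant components `v` in the preferred chart at `p`; its value
at `p` is `v`. In that chart it is the coordinate field `v ^ k ∂ₖ`. -/
def coordField (p : M) (v : TangentSpace 𝓘(ℝ, E) p) (q : M) : TangentSpace 𝓘(ℝ, E) q :=
  FiberBundle.extend E v q

/-- The components of a tangent vector `v` at `q` in the preferred chart at `p`. -/
def coords (p q : M) (v : TangentSpace 𝓘(ℝ, E) q) : E :=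
  (trivializationAt E (TangentSpace 𝓘(ℝ, E) : M → Type _) p ⟨q, v⟩).2

variable [FiniteDimensional ℝ E] [RiemannianBundle (fun x : M => TangentSpace 𝓘(ℝ, E) x)]

/-- `metricDeriv p u v w` is `∂_u g(∂_v, ∂_w)` at `p`, computed in the preferred chart at `p`. -/
def metricDeriv (p : M) (u v w : TangentSpace 𝓘(ℝ, E) p) : ℝ :=
  dirDeriv (fun q : M => inner ℝ (coordField p v q) (coordField p w q)) p u

/-- The Christoffel symbols of the Levi-Civita connection at `p` in the preferred chart at `p`:
`Γ(u, v)` is the vector with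
`2 g(Γ(u, v), w) = ∂_u g(∂_v, ∂_w) + ∂_v g(∂_u, ∂_w) - ∂_w g(∂_u, ∂_v)`,
written in an orthonormal basis of the tangent space at `p`. -/
def christoffel (p : M) (u v : TangentSpace 𝓘(ℝ, E) p) : TangentSpace 𝓘(ℝ, E) p :=
  ∑ i, ((1 / 2 : ℝ) *
      (metricDeriv p u v (stdOrthonormalBasis ℝ (TangentSpace 𝓘(ℝ, E) p) i)
        + metricDeriv p v u (stdOrthonormalBasis ℝ (TangentSpace 𝓘(ℝ, E) p) i)
        - metricDeriv p (stdOrthonormalBasis ℝ (TangentSpace 𝓘(ℝ, E) p) i) u v)) •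
    stdOrthonormalBasis ℝ (TangentSpace 𝓘(ℝ, E) p) i

/-- The Levi-Civita covariant derivative `∇_u X` at `p` of a vector field `X`, in the preferred
chart at `p`: `(∇_u X) ^ k = ∂_u X ^ k + Γ ^ k (u, X)`. -/
def covDeriv (X : ∀ q : M, TangentSpace 𝓘(ℝ, E) q) (p : M) (u : TangentSpace 𝓘(ℝ, E) p) :
    TangentSpace 𝓘(ℝ, E) p :=
  (show TangentSpace 𝓘(ℝ, E) p from dirDeriv (W := E) (fun q : M => coords p q (X q)) p u)
    + christoffel p u (X p)

/-- `e` is a smooth orthonormal frame, over `U`, of the distribution `D`. -/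
structure IsOrthonormalFrameOn (D : ∀ x : M, Submodule ℝ (TangentSpace 𝓘(ℝ, E) x)) (U : Set M)
    {n : ℕ} (e : Fin n → ∀ x : M, TangentSpace 𝓘(ℝ, E) x) : Prop where
  smooth : ∀ i, ContMDiffOn 𝓘(ℝ, E) 𝓘(ℝ, E).tangent ∞
    (fun x => (⟨x, e i x⟩ : TangentBundle 𝓘(ℝ, E) M)) U
  orthonormal : ∀ x ∈ U, Orthonormal ℝ (fun i => e i x)
  span_eq : ∀ x ∈ U, Submodule.span ℝ (Set.range fun i => e i x) = D x

/-- `J` is the complex structure of a Kähler manifold, the metric being the Riemannian metric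
of `M`: it is smooth, `J ^ 2 = -1`, `g(J v, J w) = g(v, w)` and `∇ J = 0`. -/
structure IsKahler (J : ∀ x : M, TangentSpace 𝓘(ℝ, E) x →L[ℝ] TangentSpace 𝓘(ℝ, E) x) :
    Prop where
  smooth : ContMDiff 𝓘(ℝ, E) (𝓘(ℝ, E).prod 𝓘(ℝ, E →L[ℝ] E)) ∞
    (fun x => Bundle.TotalSpace.mk' (E →L[ℝ] E)
      (E := fun x : M => TangentSpace 𝓘(ℝ, E) x →L[ℝ] TangentSpace 𝓘(ℝ, E) x) x (J x))
  sq : ∀ (x : M) (v : TangentSpace 𝓘(ℝ, E) x), J x (J x v) = -v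
  inner_eq : ∀ (x : M) (v w : TangentSpace 𝓘(ℝ, E) x), inner ℝ (J x v) (J x w) = inner ℝ v w
  parallel : ∀ (p : M) (u : TangentSpace 𝓘(ℝ, E) p) (Y : ∀ x : M, TangentSpace 𝓘(ℝ, E) x),
    ContMDiffAt 𝓘(ℝ, E) 𝓘(ℝ, E).tangent ∞
      (fun x => (⟨x, Y x⟩ : TangentBundle 𝓘(ℝ, E) M)) p →
    covDeriv (fun x => J x (Y x)) p u = J p (covDeriv Y p u)

end Basics

/-- The angle, in `[0, π / 2]`, between a nonzero vector `w` and a subspace `U`. -/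
def angleWithSubspace {V : Type*} [NormedAddCommGroup V] [InnerProductSpace ℝ V]
    (U : Submodule ℝ V) [U.HasOrthogonalProjection] (w : V) : ℝ :=
  Real.arccos (‖U.starProjection w‖ / ‖w‖)

section Maps

variable {E : Type*} [NormedAddCommGroup E] [NormedSpace ℝ E]
  {L : Type*} [TopologicalSpace L] [ChartedSpace E L]
  {F : Type*} [NormedAddCommGroup F] [NormedSpace ℝ F]
  {K : Type*} [TopologicalSpace K] [ChartedSpace F K]

/-- The differential `G_*` at `p`. -/
def differential (G : L → K) (p : L) :
    TangentSpace 𝓘(ℝ, E) p →L[ℝ] TangentSpace 𝓘(ℝ, F) (G p) :=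
  mfderiv 𝓘(ℝ, E) 𝓘(ℝ, F) G p

/-- The vertical space `ker G_*` at `p`. -/
def vertical (G : L → K) (p : L) : Submodule ℝ (TangentSpace 𝓘(ℝ, E) p) :=
  (differential (E := E) (F := F) G p).toLinearMap.ker

/-- The space `range G_*` at `p`, a subspace of the tangent space of the target at `G p`. -/
def rangeSpace (G : L → K) (p : L) : Submodule ℝ (TangentSpace 𝓘(ℝ, F) (G p)) :=
  (differential (E := E) (F := F) G p).toLinearMap.range

variable [IsManifold 𝓘(ℝ, E) ∞ L] [IsManifold 𝓘(ℝ, F) ∞ K]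
  [FiniteDimensional ℝ E] [FiniteDimensional ℝ F]
  [RiemannianBundle (fun x : L => TangentSpace 𝓘(ℝ, E) x)]
  [RiemannianBundle (fun x : K => TangentSpace 𝓘(ℝ, F) x)]

/-- The horizontal space `(ker G_*)ᗮ` at `p`. -/
def horizontal (F : Type*) [NormedAddCommGroup F] [NormedSpace ℝ F]
    {K : Type*} [TopologicalSpace K] [ChartedSpace F K]
    (G : L → K) (p : L) : Submodule ℝ (TangentSpace 𝓘(ℝ, E) p) :=
  (vertical (F := F) G p)ᗮ

variable (E) in
/-- The component in `range G_*` of a tangent vector of the target at `G p`. -/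
def rangePart (G : L → K) (p : L) (w : TangentSpace 𝓘(ℝ, F) (G p)) :
    TangentSpace 𝓘(ℝ, F) (G p) :=
  (rangeSpace (E := E) G p).starProjection w

variable (E) in
/-- The component in `(range G_*)ᗮ` of a tangent vector of the target at `G p`. -/
def normalPart (G : L → K) (p : L) (w : TangentSpace 𝓘(ℝ, F) (G p)) :
    TangentSpace 𝓘(ℝ, F) (G p) :=
  (rangeSpace (E := E) G p)ᗮ.starProjection w

/-- The covariant derivative `∇ ^ G _u V` at `p` of a vector field `V` along `G`, for the pullback
of the Levi-Civita connection of the target, in the preferred chart at `G p`: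
`(∇ ^ G _u V) ^ k = ∂_u V ^ k + Γ ^ k (G_* u, V)`. -/
def covDerivAlong (G : L → K) (V : ∀ q : L, TangentSpace 𝓘(ℝ, F) (G q)) (p : L)
    (u : TangentSpace 𝓘(ℝ, E) p) : TangentSpace 𝓘(ℝ, F) (G p) :=
  (show TangentSpace 𝓘(ℝ, F) (G p) from dirDeriv (W := F) (fun q : L => coords (G p) (G q) (V q)) p u)
    + christoffel (G p) (differential G p u) (V p)

/-- The second fundamental form `(∇ G_*)(u, v) = ∇ ^ G _u (G_* Y) - G_* (∇_u Y)` at `p`, where `Y`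
extends `v`. -/
def secondFundamentalForm (G : L → K) (p : L) (u v : TangentSpace 𝓘(ℝ, E) p) :
    TangentSpace 𝓘(ℝ, F) (G p) :=
  covDerivAlong G (fun q => differential G q (coordField p v q)) p u
    - differential G p (covDeriv (coordField p v) p u)

/-- The tension field of `G`, the trace of the second fundamental form. -/
def tension (E : Type*) [NormedAddCommGroup E] [NormedSpace ℝ E] [ChartedSpace E L]
    [IsManifold 𝓘(ℝ, E) ∞ L] [FiniteDimensional ℝ E]
    [RiemannianBundle (fun x : L => TangentSpace 𝓘(ℝ, E) x)]
    (G : L → K) (p : L) : TangentSpace 𝓘(ℝ, F) (G p) :=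
  ∑ i, secondFundamentalForm G p (stdOrthonormalBasis ℝ (TangentSpace 𝓘(ℝ, E) p) i)
    (stdOrthonormalBasis ℝ (TangentSpace 𝓘(ℝ, E) p) i)

variable (E F) in
/-- `G` is harmonic: it is smooth and its tension field vanishes. -/
def IsHarmonic (G : L → K) : Prop :=
  ContMDiff 𝓘(ℝ, E) 𝓘(ℝ, F) ∞ G ∧ ∀ p : L, tension (F := F) E G p = 0

variable (E F) in
/-- `G` is a conformal Riemannian map with dilation `lam`. -/
structure IsConformalRiemannianMap (G : L → K) (lam : L → ℝ) : Prop where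
  smooth : ContMDiff 𝓘(ℝ, E) 𝓘(ℝ, F) ∞ G
  smooth_dilation : ContMDiff 𝓘(ℝ, E) 𝓘(ℝ, ℝ) ∞ lam
  dilation_pos : ∀ p, 0 < lam p
  inner_eq : ∀ (p : L), ∀ u ∈ horizontal (E := E) F G p, ∀ v ∈ horizontal (E := E) F G p,
    inner ℝ (differential (F := F) G p u) (differential (F := F) G p v)
      = lam p ^ 2 * inner ℝ u v

variable (E) in
/-- `G` is a conformal pointwise slant Riemannian map into `(K, J)`, with dilation `lam` and slant
function `Θ`: at each point `p`, the angle between `J v` and `range G_*` is `Θ p` for all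
nonzero `v` in `range G_*`. -/
structure IsCPSRM (G : L → K)
    (J : ∀ x : K, TangentSpace 𝓘(ℝ, F) x →L[ℝ] TangentSpace 𝓘(ℝ, F) x) (lam Θ : L → ℝ) :
    Prop where
  conformal : IsConformalRiemannianMap E F G lam
  smooth_slant : ContMDiff 𝓘(ℝ, E) 𝓘(ℝ, ℝ) ∞ Θ
  angle_eq : ∀ (p : L), ∀ v ∈ rangeSpace (E := E) G p, v ≠ 0 →
    angleWithSubspace (rangeSpace (E := E) G p) (J (G p) v) = Θ p

/-- The shape operator `S_V (G_* u)` of a section `V` of `(range G_*)ᗮ`: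
minus the `range G_*` component of `∇ ^ G _u V`. -/
def shapeOperator (G : L → K) (V : ∀ q : L, TangentSpace 𝓘(ℝ, F) (G q)) (p : L)
    (u : TangentSpace 𝓘(ℝ, E) p) : TangentSpace 𝓘(ℝ, F) (G p) :=
  -rangePart E G p (covDerivAlong G V p u)

/-- The normal connection `∇ ^ {G ⊥}_u V`, the `(range G_*)ᗮ` component of `∇ ^ G _u V`. -/
def normalConnection (G : L → K) (V : ∀ q : L, TangentSpace 𝓘(ℝ, F) (G q)) (p : L)
    (u : TangentSpace 𝓘(ℝ, E) p) : TangentSpace 𝓘(ℝ, F) (G p) :=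
  normalPart E G p (covDerivAlong G V p u)

/-- The map `*G_*` at `p`: the adjoint of `G_*` with respect to `g_L` and the rescaled metric
`lam ^ (-2) g_K`, that is `g_L(*G_* w, u) = lam ^ (-2) g_K(w, G_* u)`. For a conformal Riemannian
map with dilation `lam` it is zero on `(range G_*)ᗮ`, and on `range G_*` it inverts the restriction
of `G_*` to the horizontal space. -/
def adjointMap (G : L → K) (lam : L → ℝ) (p : L) (w : TangentSpace 𝓘(ℝ, F) (G p)) :
    TangentSpace 𝓘(ℝ, E) p :=
  (lam p ^ 2)⁻¹ • LinearMap.adjoint (differential (E := E) G p).toLinearMap w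

section Components

variable (E) (G : L → K)
  (J : ∀ x : K, TangentSpace 𝓘(ℝ, F) x →L[ℝ] TangentSpace 𝓘(ℝ, F) x) (p : L)
  (w : TangentSpace 𝓘(ℝ, F) (G p))

/-- `ρ w` for `w` in `range G_*`: the `range G_*` component of `J w`. -/
def rho : TangentSpace 𝓘(ℝ, F) (G p) := rangePart E G p (J (G p) w)

/-- `ϖ w` for `w` in `range G_*`: the `(range G_*)ᗮ` component of `J w`. -/
def varpi : TangentSpace 𝓘(ℝ, F) (G p) := normalPart E G p (J (G p) w)

/-- `𝒟 w` for `w` in `(range G_*)ᗮ`: the `range G_*` component of `J w`. -/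
def calD : TangentSpace 𝓘(ℝ, F) (G p) := rangePart E G p (J (G p) w)

/-- `ℰ w` for `w` in `(range G_*)ᗮ`: the `(range G_*)ᗮ` component of `J w`. -/
def calE : TangentSpace 𝓘(ℝ, F) (G p) := normalPart E G p (J (G p) w)

end Components

/-- The vector field `*G_*(𝒟 ϖ G_* Y)` on the source. -/
def adjointDVarpi (G : L → K)
    (J : ∀ x : K, TangentSpace 𝓘(ℝ, F) x →L[ℝ] TangentSpace 𝓘(ℝ, F) x) (lam : L → ℝ)
    (Y : ∀ q : L, TangentSpace 𝓘(ℝ, E) q) (q : L) : TangentSpace 𝓘(ℝ, E) q :=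
  adjointMap G lam q (calD E G J q (varpi E G J q (differential G q (Y q))))

/-- The `range G_*` expression in a horizontal vector field `Y`:
`S_{ϖ ρ G_* Y} G_* Y + S_{ℰ ϖ G_* Y} G_* Y - G_* (∇_Y *G_*(𝒟 ϖ G_* Y))`
`- ((∇ G_*)(Y, *G_*(𝒟 ϖ G_* Y))) ^ {range} - sin 2Θ Y(Θ) G_* Y - sin ^ 2 Θ G_* (∇_Y Y)`. -/
def rangeExpression (G : L → K)
    (J : ∀ x : K, TangentSpace 𝓘(ℝ, F) x →L[ℝ] TangentSpace 𝓘(ℝ, F) x) (lam Θ : L → ℝ)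
    (Y : ∀ q : L, TangentSpace 𝓘(ℝ, E) q) (p : L) : TangentSpace 𝓘(ℝ, F) (G p) :=
  shapeOperator G (fun q => varpi E G J q (rho E G J q (differential G q (Y q)))) p (Y p)
  + shapeOperator G (fun q => calE E G J q (varpi E G J q (differential G q (Y q)))) p (Y p)
  - differential G p (covDeriv (adjointDVarpi G J lam Y) p (Y p))
  - rangePart E G p (secondFundamentalForm G p (Y p) (adjointDVarpi G J lam Y p))
  - (Real.sin (2 * Θ p) * dirDeriv Θ p (Y p)) • differential G p (Y p)
  - (Real.sin (Θ p) ^ 2) • differential G p (covDeriv Y p (Y p))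

/-- The `(range G_*)ᗮ` expression in a horizontal vector field `Y`:
`∇ ^ {G ⊥}_Y ϖ ρ G_* Y + ((∇ G_*)(Y, *G_*(𝒟 ϖ G_* Y))) ^ ⊥ + ∇ ^ {G ⊥}_Y ℰ ϖ G_* Y`. -/
def normalExpression (G : L → K)
    (J : ∀ x : K, TangentSpace 𝓘(ℝ, F) x →L[ℝ] TangentSpace 𝓘(ℝ, F) x) (lam : L → ℝ)
    (Y : ∀ q : L, TangentSpace 𝓘(ℝ, E) q) (p : L) : TangentSpace 𝓘(ℝ, F) (G p) :=
  normalConnection G (fun q => varpi E G J q (rho E G J q (differential G q (Y q)))) p (Y p)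
  + normalPart E G p (secondFundamentalForm G p (Y p) (adjointDVarpi G J lam Y p))
  + normalConnection G (fun q => calE E G J q (varpi E G J q (differential G q (Y q)))) p (Y p)

/-- The trace over the horizontal distribution of the expression `Q` in a vector field vanishes:
near each point `p` there is a smooth orthonormal frame `e₁, …, eₙ` of `(ker G_*)ᗮ` with
`∑ Q(eᵢ) = 0` at `p`. -/
def HorizontalTraceEqZero (G : L → K)
    (Q : (∀ q : L, TangentSpace 𝓘(ℝ, E) q) → ∀ p : L, TangentSpace 𝓘(ℝ, F) (G p)) : Prop :=
  ∀ p : L, ∃ (U : Set L) (n : ℕ) (e : Fin n → ∀ q : L, TangentSpace 𝓘(ℝ, E) q),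
    IsOpen U ∧ p ∈ U ∧ IsOrthonormalFrameOn (horizontal F G) U e ∧ ∑ i, Q (e i) p = 0

variable (E F) in
/-- The fibers of `G` are minimal: near each point `p` there is a smooth orthonormal frame
`w₁, …, wₘ` of `ker G_*` such that the mean curvature vector of the fiber, the horizontal component
of `∑ ∇_{wᵢ} wᵢ`, vanishes at `p`. -/
def HasMinimalFibers (G : L → K) : Prop :=
  ∀ p : L, ∃ (U : Set L) (m : ℕ) (w : Fin m → ∀ q : L, TangentSpace 𝓘(ℝ, E) q),
    IsOpen U ∧ p ∈ U ∧ IsOrthonormalFrameOn (vertical (F := F) G) U w ∧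
    (horizontal F G p).starProjection (∑ i, covDeriv (w i) p (w i p)) = 0

end Maps

end

end SlantRiemannianMap

/-! On `range G_*` the identity `J² = -1` splits into a tangential part `ρ² + 𝒟ϖ = -1` and a normal
part `ϖρ + ℰϖ = 0`. The slant condition gives `ρ² = -cos² Θ` (`starProjection_sq_of_slant`), hence
`𝒟ϖ = -sin² Θ` (`IsCPSRM.calD_varpi`), and for horizontal `Y` the field `*G_*(𝒟ϖG_*Y)` is simply
`-sin² Θ Y`.

Substitute this in the two traced expressions. The terms in `ϖρ` and `ℰϖ` cancel in pairs, and the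
Leibniz rule for `-sin² Θ Y` produces exactly the terms needed to cancel `sin 2Θ Y(Θ) G_*Y` and
`sin² Θ G_*(∇_Y Y)`. What remains is `sin² Θ` times the range part of `(∇G_*)(Y, Y)`, respectively
`-sin² Θ` times its normal part (`IsCPSRM.rangeExpression_eq`, `IsCPSRM.normalExpression_eq`).

Minimality of the fibers kills the vertical trace of `∇G_*`, so the tension field is the horizontal
trace (`tension_eq_sum_horizontal`). Conditions (i) and (ii) then annihilate its two components
wherever `sin Θ ≠ 0`, which follows from `Θ ≠ 0` because an angle with a subspace lies in `[0, π/2]`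
(`sin_slant_pos`).

The analytic input is that `∇G_*`, defined through coordinate extensions, is tensorial and bilinear
(`tensorial_eq`, `secondFundamentalForm_eq`). -/

namespace SlantRiemannianMap

/-! ### Components of tangent vectors and coordinate fields. -/

section TangentCoordinates

variable {E : Type*} [NormedAddCommGroup E] [NormedSpace ℝ E]
  {M : Type*} [TopologicalSpace M] [ChartedSpace E M] [IsManifold 𝓘(ℝ, E) ∞ M]

/-- The components are given by a coordinate change of the tangent bundle core, a linear map at
every `q`; no base set condition is needed. -/
lemma coords_add (p q : M) (v w : TangentSpace 𝓘(ℝ, E) q) :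
    coords p q (v + w) = coords p q v + coords p q w :=
  map_add ((tangentBundleCore 𝓘(ℝ, E) M).coordChange (achart E q) (achart E p) q) v w

lemma coords_smul (p q : M) (c : ℝ) (v : TangentSpace 𝓘(ℝ, E) q) :
    coords p q (c • v) = c • coords p q v :=
  map_smul ((tangentBundleCore 𝓘(ℝ, E) M).coordChange (achart E q) (achart E p) q) c v

lemma coords_zero (p q : M) : coords p q (0 : TangentSpace 𝓘(ℝ, E) q) = 0 :=
  map_zero ((tangentBundleCore 𝓘(ℝ, E) M).coordChange (achart E q) (achart E p) q)

lemma coords_self (p : M) (v : TangentSpace 𝓘(ℝ, E) p) : coords p p v = v :=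
  (tangentBundleCore 𝓘(ℝ, E) M).coordChange_self (achart E p) p (mem_chart_source E p) v

lemma coordField_self (p : M) (v : TangentSpace 𝓘(ℝ, E) p) : coordField p v p = v :=
  FiberBundle.extend_apply_self E v

lemma coordField_add (p : M) (v w : TangentSpace 𝓘(ℝ, E) p) {q : M}
    (hq : q ∈ (trivializationAt E (TangentSpace 𝓘(ℝ, E) : M → Type _) p).baseSet) :
    coordField p (v + w) q = coordField p v q + coordField p w q := by
  have h := coords_add p p v w
  simp only [coords] at h
  simp only [coordField, FiberBundle.extend, h]
  rw [← Trivialization.coe_symmₗ (R := ℝ) _ hq]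
  exact map_add ((trivializationAt E (TangentSpace 𝓘(ℝ, E) : M → Type _) p).symmₗ ℝ q) _ _

lemma coordField_smul (p : M) (c : ℝ) (v : TangentSpace 𝓘(ℝ, E) p) {q : M}
    (hq : q ∈ (trivializationAt E (TangentSpace 𝓘(ℝ, E) : M → Type _) p).baseSet) :
    coordField p (c • v) q = c • coordField p v q := by
  have h := coords_smul p p c v
  simp only [coords] at h
  simp only [coordField, FiberBundle.extend, h]
  rw [← Trivialization.coe_symmₗ (R := ℝ) _ hq]
  exact map_smul ((trivializationAt E (TangentSpace 𝓘(ℝ, E) : M → Type _) p).symmₗ ℝ q) _ _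

/-- Near `p`, a tangent vector at `q` is the value at `q` of the coordinate field with the same
components. -/
lemma coordField_coords (p : M) {q : M}
    (hq : q ∈ (trivializationAt E (TangentSpace 𝓘(ℝ, E) : M → Type _) p).baseSet)
    (v : TangentSpace 𝓘(ℝ, E) q) :
    coordField p (show TangentSpace 𝓘(ℝ, E) p from coords (E := E) p q v) q = v := by
  have h := coords_self p (show TangentSpace 𝓘(ℝ, E) p from coords (E := E) p q v)
  simp only [coords] at h
  simp only [coordField, FiberBundle.extend, coords]
  erw [h]
  exact (trivializationAt E (TangentSpace 𝓘(ℝ, E) : M → Type _) p).symm_apply_apply_mk hq v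

lemma contMDiffAt_coordField (p : M) (v : TangentSpace 𝓘(ℝ, E) p) :
    ContMDiffAt 𝓘(ℝ, E) 𝓘(ℝ, E).tangent ∞
      (fun q => (⟨q, coordField p v q⟩ : TangentBundle 𝓘(ℝ, E) M)) p :=
  FiberBundle.contMDiffAt_extend (𝓘(ℝ, E)) E v

lemma eventually_mem_baseSet (p : M) :
    ∀ᶠ q in 𝓝 p, q ∈ (trivializationAt E (TangentSpace 𝓘(ℝ, E) : M → Type _) p).baseSet :=
  (trivializationAt E (TangentSpace 𝓘(ℝ, E) : M → Type _) p).open_baseSet.mem_nhds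
    (FiberBundle.mem_baseSet_trivializationAt' p)

end TangentCoordinates

/-! ### Rules for directional derivatives. -/

section DirDeriv

variable {E : Type*} [NormedAddCommGroup E] [NormedSpace ℝ E]
  {M : Type*} [TopologicalSpace M] [ChartedSpace E M]
  {W : Type*} [NormedAddCommGroup W] [NormedSpace ℝ W] {f g : M → W} {p : M}

lemma dirDeriv_add_dir (f : M → W) (p : M) (u v : TangentSpace 𝓘(ℝ, E) p) :
    dirDeriv f p (u + v) = dirDeriv f p u + dirDeriv f p v :=
  map_add (mfderiv 𝓘(ℝ, E) 𝓘(ℝ, W) f p) u v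

lemma dirDeriv_smul_dir (f : M → W) (p : M) (c : ℝ) (u : TangentSpace 𝓘(ℝ, E) p) :
    dirDeriv f p (c • u) = c • dirDeriv f p u :=
  map_smul (mfderiv 𝓘(ℝ, E) 𝓘(ℝ, W) f p) c u

lemma dirDeriv_congr (h : f =ᶠ[𝓝 p] g) (u : TangentSpace 𝓘(ℝ, E) p) :
    dirDeriv f p u = dirDeriv g p u := by
  simp only [dirDeriv]
  have := h.mfderiv_eq (I := 𝓘(ℝ, E)) (I' := 𝓘(ℝ, W))
  exact DFunLike.congr_fun this u

lemma dirDeriv_add (hf : MDifferentiableAt 𝓘(ℝ, E) 𝓘(ℝ, W) f p)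
    (hg : MDifferentiableAt 𝓘(ℝ, E) 𝓘(ℝ, W) g p) (u : TangentSpace 𝓘(ℝ, E) p) :
    dirDeriv (fun q => f q + g q) p u = dirDeriv f p u + dirDeriv g p u :=
  DFunLike.congr_fun (hf.hasMFDerivAt.add hg.hasMFDerivAt).mfderiv u

lemma dirDeriv_smul {c : M → ℝ} (hc : MDifferentiableAt 𝓘(ℝ, E) 𝓘(ℝ, ℝ) c p)
    (hf : MDifferentiableAt 𝓘(ℝ, E) 𝓘(ℝ, W) f p) (u : TangentSpace 𝓘(ℝ, E) p) :
    dirDeriv (fun q => c q • f q) p u = dirDeriv c p u • f p + c p • dirDeriv f p u := by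
  have h := DFunLike.congr_fun (mvfderiv_smul hc hf) u
  rw [add_comm]
  exact h

lemma dirDeriv_const_smul (c : ℝ)
    (hf : MDifferentiableAt 𝓘(ℝ, E) 𝓘(ℝ, W) f p) (u : TangentSpace 𝓘(ℝ, E) p) :
    dirDeriv (fun q => c • f q) p u = c • dirDeriv f p u :=
  DFunLike.congr_fun (hf.hasMFDerivAt.const_smul c).mfderiv u

end DirDeriv

end SlantRiemannianMap

namespace SlantRiemannianMap

/-! ### Smooth vector fields along a map. -/

section Along

variable {E : Type*} [NormedAddCommGroup E] [NormedSpace ℝ E]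
  {L : Type*} [TopologicalSpace L] [ChartedSpace E L]
  {F : Type*} [NormedAddCommGroup F] [NormedSpace ℝ F]
  {K : Type*} [TopologicalSpace K] [ChartedSpace F K] [IsManifold 𝓘(ℝ, F) ∞ K]

/-- `V` is a vector field along `G` that is smooth at `p`. -/
def SmoothAlongAt (E : Type*) [NormedAddCommGroup E] [NormedSpace ℝ E] [ChartedSpace E L]
    (G : L → K) (V : ∀ q : L, TangentSpace 𝓘(ℝ, F) (G q)) (p : L) : Prop :=
  ContMDiffAt 𝓘(ℝ, E) 𝓘(ℝ, F).tangent ∞ (fun q => (⟨G q, V q⟩ : TangentBundle 𝓘(ℝ, F) K)) p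

variable {G : L → K} {V W : ∀ q : L, TangentSpace 𝓘(ℝ, F) (G q)} {p : L}

lemma smoothAlongAt_iff :
    SmoothAlongAt E G V p ↔ ContMDiffAt 𝓘(ℝ, E) 𝓘(ℝ, F) ∞ G p ∧
      ContMDiffAt 𝓘(ℝ, E) 𝓘(ℝ, F) ∞ (fun q => coords (G p) (G q) (V q)) p :=
  contMDiffAt_totalSpace

lemma SmoothAlongAt.mdifferentiableAt_coords (hV : SmoothAlongAt E G V p) :
    MDifferentiableAt 𝓘(ℝ, E) 𝓘(ℝ, F) (fun q => coords (G p) (G q) (V q)) p :=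
  (smoothAlongAt_iff.1 hV).2.mdifferentiableAt (by simp)

lemma SmoothAlongAt.congr (hV : SmoothAlongAt E G V p) (h : ∀ᶠ q in 𝓝 p, W q = V q) :
    SmoothAlongAt E G W p :=
  ContMDiffAt.congr_of_eventuallyEq hV (h.mono fun q hq => by simp only [hq])

lemma SmoothAlongAt.add (hV : SmoothAlongAt E G V p) (hW : SmoothAlongAt E G W p) :
    SmoothAlongAt E G (fun q => V q + W q) p := by
  rw [smoothAlongAt_iff] at hV hW ⊢
  simp only [coords_add]
  exact ⟨hV.1, hV.2.add hW.2⟩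

lemma SmoothAlongAt.smul {c : L → ℝ} (hc : ContMDiffAt 𝓘(ℝ, E) 𝓘(ℝ, ℝ) ∞ c p)
    (hV : SmoothAlongAt E G V p) : SmoothAlongAt E G (fun q => c q • V q) p := by
  rw [smoothAlongAt_iff] at hV ⊢
  simp only [coords_smul]
  exact ⟨hV.1, hc.smul hV.2⟩

lemma SmoothAlongAt.zero (hG : ContMDiffAt 𝓘(ℝ, E) 𝓘(ℝ, F) ∞ G p) :
    SmoothAlongAt (F := F) E G (fun _ => 0) p := by
  rw [smoothAlongAt_iff]
  simp only [coords_zero]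
  exact ⟨hG, contMDiffAt_const⟩

lemma SmoothAlongAt.sum {ι : Type*} (s : Finset ι)
    (hG : ContMDiffAt 𝓘(ℝ, E) 𝓘(ℝ, F) ∞ G p)
    {V : ι → ∀ q : L, TangentSpace 𝓘(ℝ, F) (G q)} (hV : ∀ i ∈ s, SmoothAlongAt E G (V i) p) :
    SmoothAlongAt E G (fun q => ∑ i ∈ s, V i q) p := by
  classical
  induction s using Finset.induction_on with
  | empty => simpa using SmoothAlongAt.zero hG
  | insert a s ha ih =>
    simp only [Finset.sum_insert ha]
    exact (hV a (by simp)).add (ih fun i hi => hV i (by simp [hi]))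

/-- The restriction to `G` of a smooth vector field of the target is smooth along `G`. -/
lemma SmoothAlongAt.comp {Y : ∀ x : K, TangentSpace 𝓘(ℝ, F) x}
    (hY : ContMDiffAt 𝓘(ℝ, F) 𝓘(ℝ, F).tangent ∞
      (fun x => (⟨x, Y x⟩ : TangentBundle 𝓘(ℝ, F) K)) (G p))
    (hG : ContMDiffAt 𝓘(ℝ, E) 𝓘(ℝ, F) ∞ G p) : SmoothAlongAt E G (fun q => Y (G q)) p :=
  ContMDiffAt.comp p hY hG

/-- A tangent vector at `q`, near `p`, as the tangent vector at `p` with the same components. -/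
noncomputable def moveTo (p q : K) (v : TangentSpace 𝓘(ℝ, F) q) : TangentSpace 𝓘(ℝ, F) p :=
  (coords p q v : F)

/-- A field along `G` is near `p` a combination of the coordinate fields of the target. -/
lemma eventually_eq_sum_coordField {n : ℕ} (b : Module.Basis (Fin n) ℝ (TangentSpace 𝓘(ℝ, F) (G p)))
    (hG : ContinuousAt G p) (V : ∀ q : L, TangentSpace 𝓘(ℝ, F) (G q)) :
    ∀ᶠ q in 𝓝 p, V q = ∑ i, b.repr (moveTo (G p) (G q) (V q)) i • coordField (G p) (b i) (G q) := by
  filter_upwards [hG.eventually (eventually_mem_baseSet (E := F) (G p))] with q hq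
  let T : TangentSpace 𝓘(ℝ, F) (G p) →ₗ[ℝ] TangentSpace 𝓘(ℝ, F) (G q) :=
    { toFun := fun v => coordField (G p) v (G q)
      map_add' := fun v w => coordField_add (G p) v w hq
      map_smul' := fun c v => coordField_smul (G p) c v hq }
  have h : T (moveTo (G p) (G q) (V q)) = V q := coordField_coords (G p) hq (V q)
  conv_lhs => rw [← h, ← b.sum_repr (moveTo (G p) (G q) (V q)), map_sum]
  exact Finset.sum_congr rfl fun i _ => map_smul T _ _

lemma SmoothAlongAt.contMDiffAt_repr [FiniteDimensional ℝ F] {n : ℕ}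
    (b : Module.Basis (Fin n) ℝ (TangentSpace 𝓘(ℝ, F) (G p))) (hV : SmoothAlongAt E G V p)
    (i : Fin n) :
    ContMDiffAt 𝓘(ℝ, E) 𝓘(ℝ, ℝ) ∞ (fun q => b.repr (moveTo (G p) (G q) (V q)) i) p := by
  -- The tangent space at `G p` is the model space `F` itself, so this fixed functional can be
  -- applied to the smooth components of `V`.
  let ℓ : F →ₗ[ℝ] ℝ := b.coord i
  exact (ℓ.toContinuousLinearMap.contMDiff.contMDiffAt).comp p (smoothAlongAt_iff.1 hV).2

section Metric

variable [RiemannianBundle (fun x : K => TangentSpace 𝓘(ℝ, F) x)]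
  [IsContMDiffRiemannianBundle 𝓘(ℝ, F) ∞ F (fun x : K => TangentSpace 𝓘(ℝ, F) x)]

lemma SmoothAlongAt.inner (hV : SmoothAlongAt E G V p) (hW : SmoothAlongAt E G W p) :
    ContMDiffAt 𝓘(ℝ, E) 𝓘(ℝ, ℝ) ∞ (fun q => (inner ℝ (V q) (W q) : ℝ)) p :=
  ContMDiffAt.inner_bundle (IB := 𝓘(ℝ, F)) (n := ∞) (F := F)
    (E := fun x : K => TangentSpace 𝓘(ℝ, F) x) (b := G) (v := V) (w := W) (x := p)
    (IM := 𝓘(ℝ, E)) hV hW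

end Metric

end Along

/-! ### Symmetry and bilinearity of the Christoffel symbols. -/

section Christoffel

variable {E : Type*} [NormedAddCommGroup E] [NormedSpace ℝ E]
  {M : Type*} [TopologicalSpace M] [ChartedSpace E M] [IsManifold 𝓘(ℝ, E) ∞ M]
  [RiemannianBundle (fun x : M => TangentSpace 𝓘(ℝ, E) x)]

section Direction

variable (p : M) (u u' v w : TangentSpace 𝓘(ℝ, E) p) (c : ℝ)

lemma metricDeriv_comm : metricDeriv p u v w = metricDeriv p u w v := by
  simp only [metricDeriv, real_inner_comm]

lemma metricDeriv_add_dir :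
    metricDeriv p (u + u') v w = metricDeriv p u v w + metricDeriv p u' v w :=
  dirDeriv_add_dir _ p u u'

lemma metricDeriv_smul_dir : metricDeriv p (c • u) v w = c * metricDeriv p u v w :=
  dirDeriv_smul_dir _ p c u

lemma christoffel_comm [FiniteDimensional ℝ E] : christoffel p u v = christoffel p v u := by
  simp only [christoffel]
  refine Finset.sum_congr rfl fun i _ => ?_
  rw [metricDeriv_comm p _ u v]
  congr 1
  ring

end Direction

variable [IsContMDiffRiemannianBundle 𝓘(ℝ, E) ∞ E (fun x : M => TangentSpace 𝓘(ℝ, E) x)]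
  (p : M) (u u' v v' w : TangentSpace 𝓘(ℝ, E) p) (c : ℝ)

lemma mdifferentiableAt_inner_coordField :
    MDifferentiableAt 𝓘(ℝ, E) 𝓘(ℝ, ℝ)
      (fun q : M => (inner ℝ (coordField p v q) (coordField p w q) : ℝ)) p :=
  (SmoothAlongAt.inner (G := fun q : M => q) (contMDiffAt_coordField p v)
    (contMDiffAt_coordField p w)).mdifferentiableAt (by simp)

lemma metricDeriv_add_left :
    metricDeriv p u (v + v') w = metricDeriv p u v w + metricDeriv p u v' w := by
  simp only [metricDeriv]
  rw [← dirDeriv_add (mdifferentiableAt_inner_coordField p v w)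
    (mdifferentiableAt_inner_coordField p v' w)]
  refine dirDeriv_congr ?_ u
  filter_upwards [eventually_mem_baseSet (E := E) p] with q hq
  rw [coordField_add p v v' hq, inner_add_left]

lemma metricDeriv_smul_left :
    metricDeriv p u (c • v) w = c * metricDeriv p u v w := by
  simp only [metricDeriv]
  rw [← smul_eq_mul, ← dirDeriv_const_smul c (mdifferentiableAt_inner_coordField p v w)]
  refine dirDeriv_congr ?_ u
  filter_upwards [eventually_mem_baseSet (E := E) p] with q hq
  rw [coordField_smul p c v hq, real_inner_smul_left, smul_eq_mul]

lemma metricDeriv_add_right :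
    metricDeriv p u w (v + v') = metricDeriv p u w v + metricDeriv p u w v' := by
  simp only [metricDeriv_comm p u w, metricDeriv_add_left]

lemma metricDeriv_smul_right :
    metricDeriv p u w (c • v) = c * metricDeriv p u w v := by
  simp only [metricDeriv_comm p u w, metricDeriv_smul_left]

variable [FiniteDimensional ℝ E]

lemma christoffel_add_right : christoffel p u (v + v') = christoffel p u v + christoffel p u v' := by
  simp only [christoffel, ← Finset.sum_add_distrib, ← add_smul]
  refine Finset.sum_congr rfl fun i _ => ?_
  rw [metricDeriv_add_left, metricDeriv_add_dir, metricDeriv_add_right]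
  congr 1
  ring

lemma christoffel_smul_right : christoffel p u (c • v) = c • christoffel p u v := by
  simp only [christoffel, Finset.smul_sum, smul_smul]
  refine Finset.sum_congr rfl fun i _ => ?_
  rw [metricDeriv_smul_left, metricDeriv_smul_dir, metricDeriv_smul_right]
  congr 1
  ring

lemma christoffel_add_left : christoffel p (u + u') v = christoffel p u v + christoffel p u' v := by
  simp only [christoffel_comm p _ v, christoffel_add_right]

lemma christoffel_smul_left : christoffel p (c • u) v = c • christoffel p u v := by
  simp only [christoffel_comm p _ v, christoffel_smul_right]

end Christoffel

end SlantRiemannianMap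

namespace SlantRiemannianMap

/-! ### Tensoriality from linearity over smooth functions. -/

section Tensoriality

variable {E : Type*} [NormedAddCommGroup E] [NormedSpace ℝ E]
  {L : Type*} [TopologicalSpace L] [ChartedSpace E L]
  {F : Type*} [NormedAddCommGroup F] [NormedSpace ℝ F] [FiniteDimensional ℝ F]
  {K : Type*} [TopologicalSpace K] [ChartedSpace F K] [IsManifold 𝓘(ℝ, F) ∞ K]
  {G : L → K} {p : L} {A : Type*} [AddCommGroup A] [Module ℝ A]

/-- A local operation on fields along `G` that is linear over smooth functions depends only on
the value of the field at `p`. -/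
lemma tensorial_eq (hG : ContMDiffAt 𝓘(ℝ, E) 𝓘(ℝ, F) ∞ G p)
    (Φ : (∀ q : L, TangentSpace 𝓘(ℝ, F) (G q)) → A)
    (hcongr : ∀ V W, (∀ᶠ q in 𝓝 p, V q = W q) → Φ V = Φ W)
    (hadd : ∀ V W, SmoothAlongAt E G V p → SmoothAlongAt E G W p →
      Φ (fun q => V q + W q) = Φ V + Φ W)
    (hsmul : ∀ (c : L → ℝ) V, ContMDiffAt 𝓘(ℝ, E) 𝓘(ℝ, ℝ) ∞ c p → SmoothAlongAt E G V p →
      Φ (fun q => c q • V q) = c p • Φ V)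
    {V : ∀ q : L, TangentSpace 𝓘(ℝ, F) (G q)} (hV : SmoothAlongAt E G V p) :
    Φ V = Φ (fun q => coordField (G p) (V p) (G q)) := by
  classical
  let b := Module.finBasis ℝ (TangentSpace 𝓘(ℝ, F) (G p))
  have hb : ∀ v, SmoothAlongAt E G (fun q => coordField (G p) v (G q)) p := fun v =>
    SmoothAlongAt.comp (contMDiffAt_coordField (G p) v) hG
  have hsum : ∀ {ι : Type} (s : Finset ι) (V : ι → ∀ q : L, TangentSpace 𝓘(ℝ, F) (G q)),
      (∀ i, SmoothAlongAt E G (V i) p) →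
      Φ (fun q => ∑ i ∈ s, V i q) = ∑ i ∈ s, Φ (V i) := by
    intro ι s V hV
    induction s using Finset.induction_on with
    | empty =>
      -- The value on the zero field comes from homogeneity with the zero function.
      simpa using hsmul (fun _ => 0) (fun _ => 0) contMDiffAt_const (SmoothAlongAt.zero hG)
    | insert a s ha ih =>
      simp only [Finset.sum_insert ha, ← ih]
      exact hadd _ _ (hV a) (SmoothAlongAt.sum s hG fun i _ => hV i)
  -- The right-hand side involves `W` only through `W p`, which `V` and its coordinate extension
  -- share.
  have key : ∀ {W : ∀ q : L, TangentSpace 𝓘(ℝ, F) (G q)}, SmoothAlongAt E G W p →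
      Φ W = ∑ i, b.repr (W p) i • Φ (fun q => coordField (G p) (b i) (G q)) := by
    intro W hW
    rw [hcongr _ _ (eventually_eq_sum_coordField b hG.continuousAt W),
      hsum Finset.univ _ fun i => (hb (b i)).smul (hW.contMDiffAt_repr b i)]
    refine Finset.sum_congr rfl fun i _ => ?_
    rw [hsmul _ _ (hW.contMDiffAt_repr b i) (hb (b i))]
    congr 3
    exact coords_self (G p) (W p)
  rw [key hV, key (hb (V p))]
  simp only [coordField_self]

end Tensoriality

/-! ### The pullback connection and its Leibniz rule. -/

section PullbackConnection

variable {E : Type*} [NormedAddCommGroup E] [NormedSpace ℝ E]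
  {L : Type*} [TopologicalSpace L] [ChartedSpace E L]
  {F : Type*} [NormedAddCommGroup F] [NormedSpace ℝ F] [FiniteDimensional ℝ F]
  {K : Type*} [TopologicalSpace K] [ChartedSpace F K] [IsManifold 𝓘(ℝ, F) ∞ K]
  [RiemannianBundle (fun x : K => TangentSpace 𝓘(ℝ, F) x)]
  {G : L → K} {V W : ∀ q : L, TangentSpace 𝓘(ℝ, F) (G q)} {p : L}

lemma covDerivAlong_congr (h : ∀ᶠ q in 𝓝 p, V q = W q) (u : TangentSpace 𝓘(ℝ, E) p) :
    covDerivAlong G V p u = covDerivAlong G W p u := by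
  simp only [covDerivAlong]
  rw [h.self_of_nhds, dirDeriv_congr (g := fun q : L => coords (G p) (G q) (W q))
    (h.mono fun q hq => by simp only [hq]) u]

/-- Viewing vector fields as fields along the identity makes every rule for `covDerivAlong` a rule
for `covDeriv`. -/
lemma covDeriv_eq_covDerivAlong (Y : ∀ x : K, TangentSpace 𝓘(ℝ, F) x) (x : K)
    (u : TangentSpace 𝓘(ℝ, F) x) : covDeriv Y x u = covDerivAlong (fun y : K => y) Y x u := by
  have h : differential (fun y : K => y) x u = u :=
    DFunLike.congr_fun (mfderiv_id (I := 𝓘(ℝ, F)) (M := K) (x := x)) u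
  simp only [covDeriv, covDerivAlong, h]

variable [IsContMDiffRiemannianBundle 𝓘(ℝ, F) ∞ F (fun x : K => TangentSpace 𝓘(ℝ, F) x)]

lemma covDerivAlong_add_dir (V : ∀ q : L, TangentSpace 𝓘(ℝ, F) (G q))
    (u v : TangentSpace 𝓘(ℝ, E) p) :
    covDerivAlong G V p (u + v) = covDerivAlong G V p u + covDerivAlong G V p v := by
  simp only [covDerivAlong, map_add, christoffel_add_left]
  rw [dirDeriv_add_dir]
  exact add_add_add_comm (G := TangentSpace 𝓘(ℝ, F) (G p)) _ _ _ _

lemma covDerivAlong_smul_dir (V : ∀ q : L, TangentSpace 𝓘(ℝ, F) (G q)) (c : ℝ)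
    (u : TangentSpace 𝓘(ℝ, E) p) :
    covDerivAlong G V p (c • u) = c • covDerivAlong G V p u := by
  simp only [covDerivAlong, map_smul, christoffel_smul_left]
  rw [dirDeriv_smul_dir]
  exact (smul_add (A := TangentSpace 𝓘(ℝ, F) (G p)) c _ _).symm

lemma covDerivAlong_add (hV : SmoothAlongAt E G V p) (hW : SmoothAlongAt E G W p)
    (u : TangentSpace 𝓘(ℝ, E) p) :
    covDerivAlong G (fun q => V q + W q) p u
      = covDerivAlong G V p u + covDerivAlong G W p u := by
  simp only [covDerivAlong, coords_add, christoffel_add_right]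
  rw [dirDeriv_add hV.mdifferentiableAt_coords hW.mdifferentiableAt_coords]
  exact add_add_add_comm (G := TangentSpace 𝓘(ℝ, F) (G p)) _ _ _ _

lemma covDerivAlong_smul {c : L → ℝ} (hc : ContMDiffAt 𝓘(ℝ, E) 𝓘(ℝ, ℝ) ∞ c p)
    (hV : SmoothAlongAt E G V p) (u : TangentSpace 𝓘(ℝ, E) p) :
    covDerivAlong G (fun q => c q • V q) p u
      = dirDeriv c p u • V p + c p • covDerivAlong G V p u := by
  simp only [covDerivAlong, coords_smul, christoffel_smul_right]
  rw [dirDeriv_smul (hc.mdifferentiableAt (by simp)) hV.mdifferentiableAt_coords, coords_self]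
  exact (add_assoc (G := TangentSpace 𝓘(ℝ, F) (G p)) _ _ _).trans
    (congrArg _ (smul_add (A := TangentSpace 𝓘(ℝ, F) (G p)) _ _ _).symm)

/-- Negation commutes with the derivative even where the latter takes its default value, so no
smoothness of `V` is required. This lets the `ϖρ` and `ℰϖ` terms cancel without proving those fields
smooth. -/
lemma covDerivAlong_neg (V : ∀ q : L, TangentSpace 𝓘(ℝ, F) (G q)) (u : TangentSpace 𝓘(ℝ, E) p) :
    covDerivAlong G (fun q => -V q) p u = -covDerivAlong G V p u := by
  have h : ∀ q : L, coords (G p) (G q) (-V q) = -coords (G p) (G q) (V q) := fun q => by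
    simpa using coords_smul (G p) (G q) (-1) (V q)
  have h' : christoffel (G p) (differential G p u) (-V p)
      = -christoffel (G p) (differential G p u) (V p) := by
    simpa using christoffel_smul_right (G p) (differential G p u) (V p) (-1)
  have h'' : dirDeriv (fun q : L => -coords (G p) (G q) (V q)) p u
      = -dirDeriv (fun q : L => coords (G p) (G q) (V q)) p u :=
    DFunLike.congr_fun (mvfderiv_neg (I := 𝓘(ℝ, E))
      (g := fun q : L => coords (G p) (G q) (V q)) (x := p)) u
  simp only [covDerivAlong, h, h', h'']
  exact (neg_add (α := TangentSpace 𝓘(ℝ, F) (G p)) _ _).symm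

end PullbackConnection

/-! ### Smooth vector fields and their images under the differential. -/

section SmoothField

variable {E : Type*} [NormedAddCommGroup E] [NormedSpace ℝ E]
  {L : Type*} [TopologicalSpace L] [ChartedSpace E L] [IsManifold 𝓘(ℝ, E) ∞ L]
  {F : Type*} [NormedAddCommGroup F] [NormedSpace ℝ F]
  {K : Type*} [TopologicalSpace K] [ChartedSpace F K] [IsManifold 𝓘(ℝ, F) ∞ K]
  {G : L → K} {p : L}

/-- `X` is a vector field that is smooth at `p`. -/
def SmoothFieldAt (X : ∀ q : L, TangentSpace 𝓘(ℝ, E) q) (p : L) : Prop :=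
  ContMDiffAt 𝓘(ℝ, E) 𝓘(ℝ, E).tangent ∞ (fun q => (⟨q, X q⟩ : TangentBundle 𝓘(ℝ, E) L)) p

lemma SmoothFieldAt.map_differential {X : ∀ q : L, TangentSpace 𝓘(ℝ, E) q} (hX : SmoothFieldAt X p)
    (hG : ContMDiff 𝓘(ℝ, E) 𝓘(ℝ, F) ∞ G) :
    SmoothAlongAt E G (fun q => differential (F := F) G q (X q)) p :=
  ContMDiffAt.comp p (hG.contMDiff_tangentMap (m := ∞) (by simp)).contMDiffAt hX

end SmoothField

/-! ### The second fundamental form as a bilinear map. -/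

section SecondFundamentalForm

variable {E : Type*} [NormedAddCommGroup E] [NormedSpace ℝ E] [FiniteDimensional ℝ E]
  {L : Type*} [TopologicalSpace L] [ChartedSpace E L] [IsManifold 𝓘(ℝ, E) ∞ L]
  [RiemannianBundle (fun x : L => TangentSpace 𝓘(ℝ, E) x)]
  [IsContMDiffRiemannianBundle 𝓘(ℝ, E) ∞ E (fun x : L => TangentSpace 𝓘(ℝ, E) x)]
  {F : Type*} [NormedAddCommGroup F] [NormedSpace ℝ F] [FiniteDimensional ℝ F]
  {K : Type*} [TopologicalSpace K] [ChartedSpace F K] [IsManifold 𝓘(ℝ, F) ∞ K]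
  [RiemannianBundle (fun x : K => TangentSpace 𝓘(ℝ, F) x)]
  [IsContMDiffRiemannianBundle 𝓘(ℝ, F) ∞ F (fun x : K => TangentSpace 𝓘(ℝ, F) x)]
  {G : L → K} {p : L}

/-- Replacing `X` by `c X` adds `dc(u) G_*X` to both terms, and these cancel. The difference is
therefore tensorial, and any smooth extension may replace the coordinate one. -/
lemma secondFundamentalForm_eq {X : ∀ q : L, TangentSpace 𝓘(ℝ, E) q} (hX : SmoothFieldAt X p)
    (hG : ContMDiff 𝓘(ℝ, E) 𝓘(ℝ, F) ∞ G) (u : TangentSpace 𝓘(ℝ, E) p) :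
    secondFundamentalForm G p u (X p)
      = covDerivAlong G (fun q => differential (F := F) G q (X q)) p u
        - differential (F := F) G p (covDeriv X p u) := by
  symm
  refine tensorial_eq (E := E) (G := fun q : L => q) contMDiffAt_id
    (fun X => covDerivAlong G (fun q => differential (F := F) G q (X q)) p u
        - differential (F := F) G p (covDeriv X p u)) ?_ ?_ ?_ hX
  · intro V W h
    simp only [covDeriv_eq_covDerivAlong]
    rw [covDerivAlong_congr (G := fun q : L => q) h,
      covDerivAlong_congr (G := G) (V := fun q => differential (F := F) G q (V q))
      (W := fun q => differential (F := F) G q (W q))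
      (h.mono fun q hq => by simp only [hq])]
  · intro V W hV hW
    simp only [map_add, covDeriv_eq_covDerivAlong]
    rw [covDerivAlong_add (SmoothFieldAt.map_differential hV hG) (SmoothFieldAt.map_differential hW hG),
      covDerivAlong_add hV hW, map_add]
    abel
  · intro c V hc hV
    simp only [map_smul, covDeriv_eq_covDerivAlong]
    rw [covDerivAlong_smul hc (SmoothFieldAt.map_differential hV hG), covDerivAlong_smul hc hV,
      map_add, map_smul, map_smul, smul_sub]
    abel

/-- The second fundamental form at `p` as a bilinear map. -/
noncomputable def secondFundamentalFormBilin (hG : ContMDiff 𝓘(ℝ, E) 𝓘(ℝ, F) ∞ G) (p : L) :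
    TangentSpace 𝓘(ℝ, E) p →ₗ[ℝ] TangentSpace 𝓘(ℝ, E) p →ₗ[ℝ] TangentSpace 𝓘(ℝ, F) (G p) :=
  have hX : ∀ v : TangentSpace 𝓘(ℝ, E) p, SmoothFieldAt (coordField p v) p :=
    contMDiffAt_coordField p
  LinearMap.mk₂ ℝ (secondFundamentalForm G p)
    (fun u u' v => by
      simp only [secondFundamentalForm, covDerivAlong_add_dir, covDeriv_eq_covDerivAlong, map_add]
      abel)
    (fun c u v => by
      simp only [secondFundamentalForm, covDerivAlong_smul_dir, covDeriv_eq_covDerivAlong,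
        map_smul, smul_sub])
    (fun u v v' => by
      -- The sum of the two coordinate fields serves as the extension of `v + v'`.
      have h := secondFundamentalForm_eq (SmoothAlongAt.add (G := fun q : L => q) (hX v) (hX v'))
        hG u
      simp only [coordField_self] at h
      rw [h]
      simp only [map_add, covDeriv_eq_covDerivAlong, secondFundamentalForm]
      rw [covDerivAlong_add ((hX v).map_differential hG) ((hX v').map_differential hG),
        covDerivAlong_add (G := fun q : L => q) (hX v) (hX v'), map_add]
      abel)
    (fun c u v => by
      have h := secondFundamentalForm_eq (SmoothAlongAt.smul (G := fun q : L => q)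
        (c := fun _ => c) contMDiffAt_const (hX v)) hG u
      have h0 : dirDeriv (fun _ : L => c) p u = 0 :=
        DFunLike.congr_fun (mfderiv_const (I := 𝓘(ℝ, E)) (I' := 𝓘(ℝ, ℝ))) u
      simp only [coordField_self] at h
      rw [h]
      simp only [map_smul, covDeriv_eq_covDerivAlong, secondFundamentalForm]
      rw [covDerivAlong_smul contMDiffAt_const ((hX v).map_differential hG),
        covDerivAlong_smul (G := fun q : L => q) contMDiffAt_const (hX v), h0]
      simp [smul_sub])

end SecondFundamentalForm

end SlantRiemannianMap

namespace SlantRiemannianMap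

/-! ### Conformal adjoints, slant subspaces and traces. -/

section LinearAlgebra

variable {V W : Type*} [NormedAddCommGroup V] [InnerProductSpace ℝ V] [FiniteDimensional ℝ V]
  [NormedAddCommGroup W] [InnerProductSpace ℝ W] [FiniteDimensional ℝ W]

omit [FiniteDimensional ℝ W] in
-- The discarded component lies in the double orthogonal complement of the kernel, which is the
-- kernel by finite dimension.
lemma map_starProjection_ker_orthogonal (T : V →ₗ[ℝ] W) (x : V) :
    T ((LinearMap.ker T)ᗮ.starProjection x) = T x := by
  have h : x - (LinearMap.ker T)ᗮ.starProjection x ∈ (LinearMap.ker T)ᗮᗮ :=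
    Submodule.sub_starProjection_mem_orthogonal x
  rw [Submodule.orthogonal_orthogonal, LinearMap.mem_ker, map_sub, sub_eq_zero] at h
  exact h.symm

/-- The adjoint of a map that scales the inner product by `c` on the complement of its kernel is,
up to the factor `c`, a left inverse there. -/
lemma adjoint_apply_of_conformal (T : V →ₗ[ℝ] W) (c : ℝ)
    (hT : ∀ u ∈ (LinearMap.ker T)ᗮ, ∀ v ∈ (LinearMap.ker T)ᗮ, inner ℝ (T u) (T v) = c * inner ℝ u v)
    {h : V} (hh : h ∈ (LinearMap.ker T)ᗮ) : LinearMap.adjoint T (T h) = c • h := by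
  refine ext_inner_right ℝ fun x => ?_
  rw [LinearMap.adjoint_inner_left, ← map_starProjection_ker_orthogonal T x,
    hT h hh _ (Submodule.starProjection_apply_mem _ x), real_inner_smul_left]
  congr 1
  rw [← Submodule.inner_starProjection_left_eq_right, Submodule.starProjection_eq_self_iff.2 hh]

/-- If the angle between `J v` and `U` is `θ` for all nonzero `v` in `U`, then the square of the
`U`-component of `J` is `- cos ^ 2 θ` on `U`. -/
lemma starProjection_sq_of_slant (J : W →ₗ[ℝ] W) (hsq : ∀ v, J (J v) = -v)
    (hin : ∀ v w, inner ℝ (J v) (J w) = (inner ℝ v w : ℝ)) (U : Submodule ℝ W) (θ : ℝ)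
    (hθ : ∀ v ∈ U, v ≠ 0 → angleWithSubspace U (J v) = θ) {v : W} (hv : v ∈ U) :
    U.starProjection (J (U.starProjection (J v))) = -(Real.cos θ ^ 2) • v := by
  have hnorm : ∀ v, ‖J v‖ = ‖v‖ := fun v => by
    have := hin v v
    rw [real_inner_self_eq_norm_sq, real_inner_self_eq_norm_sq] at this
    exact (sq_eq_sq₀ (norm_nonneg _) (norm_nonneg _)).1 this
  have hcos : ∀ v ∈ U, ‖U.starProjection (J v)‖ ^ 2 = Real.cos θ ^ 2 * ‖v‖ ^ 2 := by
    intro v hv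
    by_cases h0 : v = 0
    · simp [h0]
    have hle : ‖U.starProjection (J v)‖ ≤ ‖J v‖ := U.norm_starProjection_apply_le (J v)
    have hpos : 0 < ‖v‖ := norm_pos_iff.2 h0
    rw [← hθ v hv h0, angleWithSubspace, Real.cos_arccos, hnorm]
    · field_simp
    · exact le_trans (by norm_num) (div_nonneg (norm_nonneg _) (norm_nonneg _))
    · exact div_le_one_of_le₀ hle (norm_nonneg _)
  -- Polarization of the norm identity `hcos`.
  have hinner : ∀ v ∈ U, ∀ w ∈ U,
      inner ℝ (U.starProjection (J v)) (U.starProjection (J w)) = Real.cos θ ^ 2 * inner ℝ v w := by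
    intro v hv w hw
    have h1 := hcos (v + w) (U.add_mem hv hw)
    rw [map_add, map_add, norm_add_sq_real, norm_add_sq_real, hcos v hv, hcos w hw] at h1
    linarith
  have hskew : ∀ v w, inner ℝ (J v) w = -(inner ℝ v (J w) : ℝ) := fun v w => by
    rw [← hin v (J w), hsq, inner_neg_right, neg_neg]
  have hmem : U.starProjection (J (U.starProjection (J v))) - -(Real.cos θ ^ 2) • v ∈ U :=
    U.sub_mem (U.starProjection_apply_mem _) (U.smul_mem _ hv)
  -- The difference `d` lies in `U`, so it is enough to test it against itself.
  rw [← sub_eq_zero, ← inner_self_eq_zero (𝕜 := ℝ)]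
  set d := U.starProjection (J (U.starProjection (J v))) - -(Real.cos θ ^ 2) • v with hd
  conv_lhs => rw [hd]
  -- With `P` the projection, self-adjointness of `P`, skewness of `J` and `d ∈ U` give `⟨PJPJv, d⟩
  -- = -⟨PJv, PJd⟩`, to which `hinner` applies.
  have h2 : inner ℝ (U.starProjection (J (U.starProjection (J v)))) d
      = -(Real.cos θ ^ 2 * inner ℝ v d) := by
    rw [U.inner_starProjection_left_eq_right, U.starProjection_eq_self_iff.2 hmem, hskew,
      ← hinner v hv d hmem, U.inner_starProjection_left_eq_right,
      U.inner_starProjection_left_eq_right, U.starProjection_eq_self_iff.2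
        (U.starProjection_apply_mem _)]
  rw [inner_sub_left, h2, real_inner_smul_left]
  ring

/-- The tensor `∑ bᵢ ⊗ bᵢ` is the same for every orthonormal basis, and the trace is its image under
the lift of `B`. -/
lemma trace_eq_of_orthonormalBasis {ι κ A : Type*} [Fintype ι] [Fintype κ] [AddCommGroup A]
    [Module ℝ A] (B : V →ₗ[ℝ] V →ₗ[ℝ] A) (b : OrthonormalBasis ι ℝ V)
    (c : OrthonormalBasis κ ℝ V) : ∑ i, B (b i) (b i) = ∑ i, B (c i) (c i) := by
  have h := (InnerProductSpace.canonicalCovariantTensor_eq_sum V b).symm.trans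
    (InnerProductSpace.canonicalCovariantTensor_eq_sum V c)
  simpa using congrArg (TensorProduct.lift B) h

/-- A trace splits along an orthogonal decomposition. -/
lemma trace_eq_add_of_orthonormal {n m : ℕ} {ι A : Type*} [Fintype ι] [AddCommGroup A] [Module ℝ A]
    (B : V →ₗ[ℝ] V →ₗ[ℝ] A) (b : OrthonormalBasis ι ℝ V) (N : Submodule ℝ V)
    {e : Fin n → V} {w : Fin m → V} (he : Orthonormal ℝ e) (hw : Orthonormal ℝ w)
    (hes : Submodule.span ℝ (Set.range e) = Nᗮ) (hws : Submodule.span ℝ (Set.range w) = N) :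
    ∑ i, B (b i) (b i) = ∑ i, B (e i) (e i) + ∑ j, B (w j) (w j) := by
  have he' : ∀ i, e i ∈ Nᗮ := fun i => hes ▸ Submodule.subset_span ⟨i, rfl⟩
  have hw' : ∀ j, w j ∈ N := fun j => hws ▸ Submodule.subset_span ⟨j, rfl⟩
  have ho : Orthonormal ℝ (Sum.elim e w) := by
    refine ⟨?_, ?_⟩
    · rintro (i | j)
      exacts [he.1 i, hw.1 j]
    · rintro (i | i) (j | j) hij
      · exact he.2 (by simpa using hij)
      · exact Submodule.inner_left_of_mem_orthogonal (hw' j) (he' i)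
      · exact Submodule.inner_right_of_mem_orthogonal (hw' i) (he' j)
      · exact hw.2 (by simpa using hij)
  have hs : ⊤ ≤ Submodule.span ℝ (Set.range (Sum.elim e w)) := by
    rw [Set.Sum.elim_range, Submodule.span_union, hes, hws, sup_comm,
      Submodule.sup_orthogonal_of_hasOrthogonalProjection]
  rw [trace_eq_of_orthonormalBasis B b (OrthonormalBasis.mk ho hs)]
  simp

end LinearAlgebra

end SlantRiemannianMap

namespace SlantRiemannianMap

set_option linter.unusedSectionVars false

/-! ### Algebra of the slant decomposition. -/

section Slant

variable {E : Type*} [NormedAddCommGroup E] [NormedSpace ℝ E] [FiniteDimensional ℝ E]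
  {L : Type*} [TopologicalSpace L] [ChartedSpace E L] [IsManifold 𝓘(ℝ, E) ∞ L]
  [RiemannianBundle (fun x : L => TangentSpace 𝓘(ℝ, E) x)]
  {F : Type*} [NormedAddCommGroup F] [NormedSpace ℝ F] [FiniteDimensional ℝ F]
  {K : Type*} [TopologicalSpace K] [ChartedSpace F K] [IsManifold 𝓘(ℝ, F) ∞ K]
  [RiemannianBundle (fun x : K => TangentSpace 𝓘(ℝ, F) x)]
  {J : ∀ x : K, TangentSpace 𝓘(ℝ, F) x →L[ℝ] TangentSpace 𝓘(ℝ, F) x}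
  {G : L → K} {lam Θ : L → ℝ} {p : L}

lemma rangePart_add_normalPart (w : TangentSpace 𝓘(ℝ, F) (G p)) :
    rangePart E G p w + normalPart E G p w = w :=
  Submodule.starProjection_add_starProjection_orthogonal w

lemma rangePart_neg (w : TangentSpace 𝓘(ℝ, F) (G p)) :
    rangePart E G p (-w) = -rangePart E G p w := by
  simp only [rangePart, map_neg]

lemma rangePart_smul (c : ℝ) (w : TangentSpace 𝓘(ℝ, F) (G p)) :
    rangePart E G p (c • w) = c • rangePart E G p w := by
  simp only [rangePart, map_smul]

lemma rangePart_sum {ι : Type*} (s : Finset ι) (w : ι → TangentSpace 𝓘(ℝ, F) (G p)) :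
    rangePart E G p (∑ i ∈ s, w i) = ∑ i ∈ s, rangePart E G p (w i) := by
  simp only [rangePart, map_sum]

lemma normalPart_neg (w : TangentSpace 𝓘(ℝ, F) (G p)) :
    normalPart E G p (-w) = -normalPart E G p w := by
  simp only [normalPart, map_neg]

lemma normalPart_sub (v w : TangentSpace 𝓘(ℝ, F) (G p)) :
    normalPart E G p (v - w) = normalPart E G p v - normalPart E G p w := by
  simp only [normalPart, map_sub]

lemma normalPart_smul (c : ℝ) (w : TangentSpace 𝓘(ℝ, F) (G p)) :
    normalPart E G p (c • w) = c • normalPart E G p w := by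
  simp only [normalPart, map_smul]

lemma normalPart_sum {ι : Type*} (s : Finset ι) (w : ι → TangentSpace 𝓘(ℝ, F) (G p)) :
    normalPart E G p (∑ i ∈ s, w i) = ∑ i ∈ s, normalPart E G p (w i) := by
  simp only [normalPart, map_sum]

lemma rangePart_of_mem {w : TangentSpace 𝓘(ℝ, F) (G p)} (hw : w ∈ rangeSpace (E := E) G p) :
    rangePart E G p w = w :=
  Submodule.starProjection_eq_self_iff.2 hw

lemma normalPart_of_mem {w : TangentSpace 𝓘(ℝ, F) (G p)} (hw : w ∈ rangeSpace (E := E) G p) :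
    normalPart E G p w = 0 := by
  have h := rangePart_add_normalPart (E := E) (G := G) (p := p) w
  rwa [rangePart_of_mem hw, add_eq_left] at h

lemma differential_mem_rangeSpace (u : TangentSpace 𝓘(ℝ, E) p) :
    differential G p u ∈ rangeSpace (E := E) (F := F) G p :=
  ⟨u, rfl⟩

lemma IsCPSRM.rho_rho (hG : IsCPSRM E G J lam Θ) (hJ : IsKahler J)
    {v : TangentSpace 𝓘(ℝ, F) (G p)} (hv : v ∈ rangeSpace (E := E) G p) :
    rho E G J p (rho E G J p v) = -(Real.cos (Θ p) ^ 2) • v :=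
  starProjection_sq_of_slant (J (G p)).toLinearMap (hJ.sq (G p)) (hJ.inner_eq (G p))
    (rangeSpace (E := E) G p) (Θ p) (hG.angle_eq p) hv

lemma varpi_eq (v : TangentSpace 𝓘(ℝ, F) (G p)) :
    varpi E G J p v = J (G p) v - rho E G J p v :=
  eq_sub_of_add_eq' (rangePart_add_normalPart (E := E) (J (G p) v))

/-- `𝒟 ϖ = - sin ^ 2 Θ` on `range G_*`. -/
lemma IsCPSRM.calD_varpi (hG : IsCPSRM E G J lam Θ) (hJ : IsKahler J)
    {v : TangentSpace 𝓘(ℝ, F) (G p)} (hv : v ∈ rangeSpace (E := E) G p) :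
    calD E G J p (varpi E G J p v) = -(Real.sin (Θ p) ^ 2) • v := by
  have h := hG.rho_rho hJ hv
  have h' : rangePart E G p (-v) = -v := rangePart_of_mem (neg_mem hv)
  -- This is the range component of `J (J v) = -v`, with `ϖ v` written as `J v - ρ v`.
  have hc : calD E G J p (varpi E G J p v) = -v - rho E G J p (rho E G J p v) := by
    rw [varpi_eq, calD, map_sub, hJ.sq, ← h', rho, rangePart, rangePart, rangePart, map_sub]
    simp only [rangePart] at h'
    rw [h', h']
    rfl
  rw [hc, h, Real.sin_sq]
  module

/-- `ℰ ϖ = - ϖ ρ` on `range G_*`. -/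
lemma IsKahler.calE_varpi (hJ : IsKahler J)
    {v : TangentSpace 𝓘(ℝ, F) (G p)} (hv : v ∈ rangeSpace (E := E) G p) :
    calE E G J p (varpi E G J p v) = -varpi E G J p (rho E G J p v) := by
  have h' : normalPart E G p (-v) = 0 := normalPart_of_mem (neg_mem hv)
  rw [varpi_eq, calE, map_sub, hJ.sq, normalPart_sub, h', zero_sub]
  rfl

/-- The adjoint composed with `G_*` is multiplication by `lam p ^ 2` on horizontal vectors; the
rescaling in `adjointMap` removes this factor. -/
lemma IsConformalRiemannianMap.adjointMap_differential (hG : IsConformalRiemannianMap E F G lam)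
    {u : TangentSpace 𝓘(ℝ, E) p} (hu : u ∈ horizontal (E := E) F G p) :
    adjointMap G lam p (differential (F := F) G p u) = u := by
  have h := adjoint_apply_of_conformal (differential (E := E) (F := F) G p).toLinearMap
    (lam p ^ 2) (hG.inner_eq p) hu
  have h0 : lam p ^ 2 ≠ 0 := pow_ne_zero 2 (hG.dilation_pos p).ne'
  have h1 : adjointMap G lam p (differential (F := F) G p u)
      = (lam p ^ 2)⁻¹ • (lam p ^ 2 • u) := congrArg _ h
  rw [h1, smul_smul, inv_mul_cancel₀ h0, one_smul]

lemma IsCPSRM.adjointDVarpi_eq (hG : IsCPSRM E G J lam Θ) (hJ : IsKahler J)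
    {Y : ∀ q : L, TangentSpace 𝓘(ℝ, E) q} (hY : Y p ∈ horizontal (E := E) F G p) :
    adjointDVarpi G J lam Y p = -(Real.sin (Θ p) ^ 2) • Y p := by
  rw [adjointDVarpi, hG.calD_varpi hJ (differential_mem_rangeSpace (Y p)),
    ← map_smul (differential (E := E) (F := F) G p), hG.conformal.adjointMap_differential
      (Submodule.smul_mem _ _ hY)]

/-- A nonzero vector in the range makes `Θ p` an actual angle in `[0, π / 2]`. For zero range the
slant condition is vacuous and puts no bound on `Θ p`. -/
lemma sin_slant_pos (hG : IsCPSRM E G J lam Θ) (hΘ : Θ p ≠ 0)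
    (h : rangeSpace (E := E) (F := F) G p ≠ ⊥) : 0 < Real.sin (Θ p) := by
  obtain ⟨v, hv, hv0⟩ := (Submodule.ne_bot_iff _).1 h
  have h1 := hG.angle_eq p v hv hv0
  rw [angleWithSubspace] at h1
  refine Real.sin_pos_of_pos_of_lt_pi (lt_of_le_of_ne ?_ hΘ.symm) ?_
  · rw [← h1]
    exact Real.arccos_nonneg _
  · rw [← h1]
    have : Real.arccos (‖(rangeSpace (E := E) G p).starProjection (J (G p) v)‖ / ‖J (G p) v‖)
        ≤ Real.pi / 2 := Real.arccos_le_pi_div_two.2 (by positivity)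
    linarith [Real.pi_pos]

end Slant

/-! ### The derivative of `-sin² Θ`. -/

section DirDerivSin

variable {E : Type*} [NormedAddCommGroup E] [NormedSpace ℝ E]
  {M : Type*} [TopologicalSpace M] [ChartedSpace E M] {Θ : M → ℝ} {p : M}

lemma dirDeriv_neg_sin_sq (hΘ : MDifferentiableAt 𝓘(ℝ, E) 𝓘(ℝ, ℝ) Θ p)
    (u : TangentSpace 𝓘(ℝ, E) p) :
    dirDeriv (fun q => -(Real.sin (Θ q) ^ 2)) p u = -(Real.sin (2 * Θ p) * dirDeriv Θ p u) := by
  have h : HasDerivAt (fun t : ℝ => -(Real.sin t ^ 2)) (-Real.sin (2 * Θ p)) (Θ p) := by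
    have := ((Real.hasDerivAt_sin (Θ p)).pow 2).neg
    refine this.congr_deriv ?_
    rw [Real.sin_two_mul]
    ring
  have h2 := DFunLike.congr_fun
    (h.hasFDerivAt.hasMFDerivAt.comp p hΘ.hasMFDerivAt).mfderiv u
  refine h2.trans ?_
  change (ContinuousLinearMap.toSpanSingleton ℝ (-Real.sin (2 * Θ p))) (dirDeriv Θ p u) = _
  rw [ContinuousLinearMap.toSpanSingleton_apply, smul_eq_mul]
  ring

end DirDerivSin

/-! ### Reduction of the two traced expressions to the second fundamental form. -/

section Expressions

variable {E : Type*} [NormedAddCommGroup E] [NormedSpace ℝ E] [FiniteDimensional ℝ E]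
  {L : Type*} [TopologicalSpace L] [ChartedSpace E L] [IsManifold 𝓘(ℝ, E) ∞ L]
  [RiemannianBundle (fun x : L => TangentSpace 𝓘(ℝ, E) x)]
  [IsContMDiffRiemannianBundle 𝓘(ℝ, E) ∞ E (fun x : L => TangentSpace 𝓘(ℝ, E) x)]
  {F : Type*} [NormedAddCommGroup F] [NormedSpace ℝ F] [FiniteDimensional ℝ F]
  {K : Type*} [TopologicalSpace K] [ChartedSpace F K] [IsManifold 𝓘(ℝ, F) ∞ K]
  [RiemannianBundle (fun x : K => TangentSpace 𝓘(ℝ, F) x)]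
  [IsContMDiffRiemannianBundle 𝓘(ℝ, F) ∞ F (fun x : K => TangentSpace 𝓘(ℝ, F) x)]
  {J : ∀ x : K, TangentSpace 𝓘(ℝ, F) x →L[ℝ] TangentSpace 𝓘(ℝ, F) x}
  {G : L → K} {lam Θ : L → ℝ} {p : L} {Y : ∀ q : L, TangentSpace 𝓘(ℝ, E) q}

lemma IsKahler.covDerivAlong_calE_varpi (hJ : IsKahler J) (u : TangentSpace 𝓘(ℝ, E) p) :
    covDerivAlong G (fun q => calE E G J q (varpi E G J q (differential G q (Y q)))) p u
      = -covDerivAlong G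
          (fun q => varpi E G J q (rho E G J q (differential (F := F) G q (Y q)))) p u := by
  rw [← covDerivAlong_neg]
  exact covDerivAlong_congr
    (.of_forall fun q => hJ.calE_varpi (differential_mem_rangeSpace (Y q))) u

lemma secondFundamentalForm_smul_right (hG : ContMDiff 𝓘(ℝ, E) 𝓘(ℝ, F) ∞ G) (c : ℝ)
    (u v : TangentSpace 𝓘(ℝ, E) p) :
    secondFundamentalForm G p u (c • v) = c • secondFundamentalForm (F := F) G p u v :=
  map_smul (secondFundamentalFormBilin hG p u) c v

/-- Horizontality is needed near `p`, not only at `p`, because the field `*G_*(𝒟ϖG_*Y) = -sin² Θ Y`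
is differentiated. -/
lemma IsCPSRM.rangeExpression_eq (hG : IsCPSRM E G J lam Θ) (hJ : IsKahler J)
    (hY : SmoothFieldAt Y p) (hYh : ∀ᶠ q in 𝓝 p, Y q ∈ horizontal (E := E) F G q) :
    rangeExpression G J lam Θ Y p
      = Real.sin (Θ p) ^ 2 • rangePart E G p (secondFundamentalForm G p (Y p) (Y p)) := by
  have hZ : ∀ᶠ q in 𝓝 p, adjointDVarpi G J lam Y q = -(Real.sin (Θ q) ^ 2) • Y q :=
    hYh.mono fun q hq => hG.adjointDVarpi_eq hJ hq
  have hΘ : ContMDiffAt 𝓘(ℝ, E) 𝓘(ℝ, ℝ) ∞ Θ p := hG.smooth_slant p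
  have hsin : ContMDiffAt 𝓘(ℝ, E) 𝓘(ℝ, ℝ) ∞ (fun q => -(Real.sin (Θ q) ^ 2)) p :=
    ((Real.contDiff_sin.pow 2).neg.contMDiff.contMDiffAt).comp p hΘ
  have hcov : covDeriv (adjointDVarpi G J lam Y) p (Y p)
      = -(Real.sin (2 * Θ p) * dirDeriv Θ p (Y p)) • Y p
        + -(Real.sin (Θ p) ^ 2) • covDeriv Y p (Y p) := by
    simp only [covDeriv_eq_covDerivAlong]
    rw [covDerivAlong_congr (G := fun q : L => q) hZ,
      covDerivAlong_smul (G := fun q : L => q) hsin hY,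
      dirDeriv_neg_sin_sq (hΘ.mdifferentiableAt (by simp))]
  rw [rangeExpression, hcov, hZ.self_of_nhds, secondFundamentalForm_smul_right hG.conformal.smooth,
    rangePart_smul, shapeOperator, shapeOperator, hJ.covDerivAlong_calE_varpi, rangePart_neg,
    map_add, map_smul,
    map_smul]
  module

/-- Here `*G_*(𝒟ϖG_*Y)` enters only through its value at `p`, so horizontality at `p` suffices. -/
lemma IsCPSRM.normalExpression_eq (hG : IsCPSRM E G J lam Θ) (hJ : IsKahler J)
    (hYh : Y p ∈ horizontal (E := E) F G p) :
    normalExpression G J lam Y p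
      = -(Real.sin (Θ p) ^ 2) • normalPart E G p (secondFundamentalForm G p (Y p) (Y p)) := by
  rw [normalExpression, hG.adjointDVarpi_eq hJ hYh,
    secondFundamentalForm_smul_right hG.conformal.smooth,
    normalPart_smul, normalConnection, normalConnection, hJ.covDerivAlong_calE_varpi, normalPart_neg]
  module

/-! ### Horizontal and vertical traces in adapted frames. -/

section Frames

variable {U : Set L} {n m : ℕ} {e : Fin n → ∀ q : L, TangentSpace 𝓘(ℝ, E) q}
  {w : Fin m → ∀ q : L, TangentSpace 𝓘(ℝ, E) q}

lemma IsOrthonormalFrameOn.smoothFieldAt {D : ∀ x : L, Submodule ℝ (TangentSpace 𝓘(ℝ, E) x)}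
    (he : IsOrthonormalFrameOn D U e) (hU : IsOpen U) (hp : p ∈ U) (i : Fin n) :
    SmoothFieldAt (e i) p :=
  (he.smooth i).contMDiffAt (hU.mem_nhds hp)

lemma IsOrthonormalFrameOn.mem {D : ∀ x : L, Submodule ℝ (TangentSpace 𝓘(ℝ, E) x)}
    (he : IsOrthonormalFrameOn D U e) (hp : p ∈ U) (i : Fin n) : e i p ∈ D p := by
  rw [← he.span_eq p hp]
  exact Submodule.subset_span ⟨i, rfl⟩

/-- The trace of the second fundamental form over the vertical space is minus the image of the
mean curvature vector of the fiber. -/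
lemma sum_secondFundamentalForm_vertical (hG : ContMDiff 𝓘(ℝ, E) 𝓘(ℝ, F) ∞ G) (hU : IsOpen U)
    (hp : p ∈ U) (hw : IsOrthonormalFrameOn (vertical (F := F) G) U w) :
    ∑ j, secondFundamentalForm (F := F) G p (w j p) (w j p)
      = -differential G p
          ((horizontal F G p).starProjection (∑ j, covDeriv (w j) p (w j p))) := by
  have hhor := map_starProjection_ker_orthogonal (differential (E := E) (F := F) G p).toLinearMap
    (∑ j, covDeriv (w j) p (w j p))
  have hhor' : differential G p
      ((horizontal F G p).starProjection (∑ j, covDeriv (w j) p (w j p)))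
      = differential (F := F) G p (∑ j, covDeriv (w j) p (w j p)) := hhor
  rw [hhor', map_sum, ← Finset.sum_neg_distrib]
  refine Finset.sum_congr rfl fun j _ => ?_
  rw [secondFundamentalForm_eq (hw.smoothFieldAt hU hp j) hG]
  have hz : covDerivAlong G (fun q => differential (F := F) G q (w j q)) p (w j p) = 0 := by
    -- Near `p` the field `G_* wⱼ` vanishes, hence equals `0 • G_* wⱼ`, whose derivative the Leibniz
    -- rule shows to be zero.
    rw [covDerivAlong_congr (W := fun q => (0 : ℝ) • differential (F := F) G q (w j q)),
      covDerivAlong_smul (c := fun _ => 0) contMDiffAt_const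
        ((hw.smoothFieldAt hU hp j).map_differential hG)]
    · have h0 : dirDeriv (fun _ : L => (0 : ℝ)) p (w j p) = 0 :=
        DFunLike.congr_fun (mfderiv_const (I := 𝓘(ℝ, E)) (I' := 𝓘(ℝ, ℝ))) (w j p)
      simp [h0]
    · filter_upwards [hU.mem_nhds hp] with q hq
      rw [zero_smul]
      exact hw.mem hq j
  rw [hz, zero_sub]

/-- The horizontal frame and the vertical one from minimality form together an orthonormal basis at
`p`. The trace may be computed in it, and its vertical part vanishes. -/
lemma tension_eq_sum_horizontal (hG : ContMDiff 𝓘(ℝ, E) 𝓘(ℝ, F) ∞ G)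
    (hmin : HasMinimalFibers E F G) (hp : p ∈ U)
    (he : IsOrthonormalFrameOn (horizontal F G) U e) :
    tension (F := F) E G p = ∑ i, secondFundamentalForm G p (e i p) (e i p) := by
  obtain ⟨U', m, w, hU', hp', hw, hH⟩ := hmin p
  have h := trace_eq_add_of_orthonormal (secondFundamentalFormBilin hG p)
    (stdOrthonormalBasis ℝ (TangentSpace 𝓘(ℝ, E) p)) (vertical (F := F) G p)
    (he.orthonormal p hp) (hw.orthonormal p hp') (he.span_eq p hp) (hw.span_eq p hp')
  have h' : tension (F := F) E G p = ∑ i, secondFundamentalForm G p (e i p) (e i p)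
      + ∑ j, secondFundamentalForm G p (w j p) (w j p) := h
  rw [h', sum_secondFundamentalForm_vertical hG hU' hp' hw, hH, map_zero, neg_zero, add_zero]

end Frames

end Expressions

end SlantRiemannianMap

/-! ### Harmonicity. -/

theorem theorem4p5
    {E : Type*} [NormedAddCommGroup E] [NormedSpace ℝ E] [FiniteDimensional ℝ E]
    {L : Type*} [TopologicalSpace L] [ChartedSpace E L] [IsManifold 𝓘(ℝ, E) ∞ L]
    [RiemannianBundle (fun x : L => TangentSpace 𝓘(ℝ, E) x)]
    [IsContMDiffRiemannianBundle 𝓘(ℝ, E) ∞ E (fun x : L => TangentSpace 𝓘(ℝ, E) x)]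
    {F : Type*} [NormedAddCommGroup F] [NormedSpace ℝ F] [FiniteDimensional ℝ F]
    {K : Type*} [TopologicalSpace K] [ChartedSpace F K] [IsManifold 𝓘(ℝ, F) ∞ K]
    [RiemannianBundle (fun x : K => TangentSpace 𝓘(ℝ, F) x)]
    [IsContMDiffRiemannianBundle 𝓘(ℝ, F) ∞ F (fun x : K => TangentSpace 𝓘(ℝ, F) x)]
    (J : ∀ x : K, TangentSpace 𝓘(ℝ, F) x →L[ℝ] TangentSpace 𝓘(ℝ, F) x)
    (hJ : SlantRiemannianMap.IsKahler J)
    (G : L → K) (lam Θ : L → ℝ)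
    (hG : SlantRiemannianMap.IsCPSRM E G J lam Θ)
    (hΘ : ∀ p : L, Θ p ≠ 0)
    (h_range : SlantRiemannianMap.HorizontalTraceEqZero (E := E) G
      (SlantRiemannianMap.rangeExpression G J lam Θ))
    (h_normal : SlantRiemannianMap.HorizontalTraceEqZero (E := E) G
      (SlantRiemannianMap.normalExpression G J lam))
    (h_minimal : SlantRiemannianMap.HasMinimalFibers E F G) :
    SlantRiemannianMap.IsHarmonic E F G := by
  have hsm := hG.conformal.smooth
  refine ⟨hsm, fun p => ?_⟩
  obtain ⟨U, n, e, hU, hp, he, hQ⟩ := h_range p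
  obtain ⟨U', n', e', hU', hp', he', hQ'⟩ := h_normal p
  -- The frames in the two conditions may differ, but both horizontal traces equal the same tension
  -- field.
  have hT := SlantRiemannianMap.tension_eq_sum_horizontal hsm h_minimal hp he
  have hT' := SlantRiemannianMap.tension_eq_sum_horizontal hsm h_minimal hp' he'
  -- Where `G_* = 0` the slant condition gives no control of `sin Θ`; there the horizontal space is
  -- zero, so the frame is empty and the trace is an empty sum.
  by_cases hbot : SlantRiemannianMap.rangeSpace (E := E) (F := F) G p = ⊥
  · have hn : IsEmpty (Fin n) := by
      refine ⟨fun i => ?_⟩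
      have h1 := he.mem hp i
      have h2 : e i p ∈ SlantRiemannianMap.vertical (F := F) G p := by
        have h3 := SlantRiemannianMap.differential_mem_rangeSpace (F := F) (G := G) (e i p)
        rw [hbot] at h3
        exact h3
      have h4 : e i p = 0 := by
        rw [← inner_self_eq_zero (𝕜 := ℝ)]
        exact Submodule.inner_right_of_mem_orthogonal h2 h1
      have h5 := (he.orthonormal p hp).1 i
      simp [h4] at h5
    rw [hT]
    exact Finset.sum_of_isEmpty _
  have hsin := (SlantRiemannianMap.sin_slant_pos hG (hΘ p) hbot).ne'
  have hr : SlantRiemannianMap.rangePart E G p (SlantRiemannianMap.tension (F := F) E G p) = 0 := by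
    simp only [hG.rangeExpression_eq hJ (he.smoothFieldAt hU hp _)
      ((hU.eventually_mem hp).mono fun q hq => he.mem hq _)] at hQ
    rw [← Finset.smul_sum, ← SlantRiemannianMap.rangePart_sum, ← hT] at hQ
    exact (smul_eq_zero.1 hQ).resolve_left (pow_ne_zero 2 hsin)
  have hn : SlantRiemannianMap.normalPart E G p (SlantRiemannianMap.tension (F := F) E G p) = 0 := by
    simp only [hG.normalExpression_eq hJ (he'.mem hp' _)] at hQ'
    rw [← Finset.smul_sum, ← SlantRiemannianMap.normalPart_sum, ← hT'] at hQ'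
    exact (smul_eq_zero.1 hQ').resolve_left (neg_ne_zero.2 (pow_ne_zero 2 hsin))
  rw [← SlantRiemannianMap.rangePart_add_normalPart (E := E)
    (SlantRiemannianMap.tension (F := F) E G p), hr, hn, add_zero]
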